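/- **Model.** Fix an input set $X=\{0,1,\dots,K\}$ and a finite output set $Y$ with a distinguished element $\emptyset\in Y$. A *network* on $n$ nodes is a connected bidirectional (simple) graph on $n$ nodes together with a port labeling: each node $i$, of degree $d(i)$, assigns distinct port numbers from $\{0,1,\dots,d(i)\}$ to its outgoing edges; the edges of $i$ are enumerated $1,\dots,d(i)$ in the order of their port numbers. An *algorithm* is a family $(A_d)_{d\ge 0}$ of finite automata, where $A_d$ has a finite internal memory set $Z_d$, where all automata share one finite message set $M$, where $Z_d$ and $M$ contain special elements $\emptyset$, and where $A_d$ is a transition law on $X\times Z_d\times Y\times M^d$ that does not change the $X$-component. On a network with initial values $x_1,\dots,x_n\in X$, node $i$ starts with memory, output and all outgoing messages equal to $\emptyset$ and at each time step $t$ sets $$[x_i,z_i(t+1),y_i(t+1);m_{i,1}(t+1),\dots,m_{i,d(i)}(t+1)]=A_{d(i)}[x_i,z_i(t),y_i(t);m_{j_1,p_1}(t),\dots,m_{j_{d(i)},p_{d(i)}}(t)],$$ where $j_k$ is the neighbor at the other end of the $k$-th edge of $i$, and $p_k$ is the index of the edge $(j_k,i)$ in the enumeration of the edges of $j_k$. A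 family of functions $f_n:X^n\to Y$, $n\ge 1$, is *computable* if there is one algorithm (independent of $n$ and of the network) such that for every $n$, every network on $n$ nodes and all $x_1,\dots,x_n\in X$ there is a time $t'$ with $y_i(t)=f_n(x_1,\dots,x_n)$ for all nodes $i$ and all $t\ge t'$. Let $D=\{(p_0,\dots,p_K)\in[0,1]^{K+1}:\sum_{k=0}^K p_k=1\}$ be the unit simplex. A function $h:D\to Y$ is *computable* if there is a computable family $(f_n)_{n\ge1}$ such that $f_n(x_1,\dots,x_n)=h(p_0,\dots,p_K)$ for all $n\ge 1$ and $x\in X^n$, where $p_k=|\{i: x_i=k\}|/n$ is the frequency of the value $k$. **Theorem (sufficient condition for computability).** Let $h:D\to Y$. Suppose that for every $y\in Y$ the level set $L(y)=\{p\in D: h(p)=y\}$ is a finite union of sets, each of which is the set of all $p\in D$ satisfying finitely many linear inequalities of the form $$\alpha_0p_0+\alpha_1p_1+\dots+\alpha_Kp_K\le\alpha\qquad\text{or}\qquad \alpha_0p_0+\alpha_1p_1+\dots+\alpha_Kp_K<\alpha$$ with rational $\alpha,\alpha_0,\dots,\alpha_K$. Then $h$ is computable. -/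

import Mathlib

namespace AnonNet

/-! ### Networks -/

open Classical in
/-- A network on `n` nodes: a connected bidirectional graph together with a port labeling.
`port i j` is the port number of the outgoing edge from `i` to `j`; it is meaningful only when
`i` and `j` are neighbors. The port numbers at `i` are distinct integers in `{0, 1, ..., d(i)}`. -/
structure Network (n : ℕ) where
  graph : SimpleGraph (Fin n)
  connected : graph.Connected
  port : Fin n → Fin n → ℕ
  port_le : ∀ i j, graph.Adj i j → port i j ≤ graph.degree i
  port_inj : ∀ i j k, graph.Adj i j → graph.Adj i k → port i j = port i k → j = k

namespace Network

variable {n : ℕ} (N : Network n)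

open Classical in
/-- The degree of a node. -/
noncomputable def deg (i : Fin n) : ℕ := N.graph.degree i

/-- The neighbors of a node. -/
abbrev Nbr (i : Fin n) : Type := {j : Fin n // N.graph.Adj i j}

open Classical in
/-- The position of the edge from `i` to `j` when the outgoing edges of `i` are listed in
increasing order of their port numbers (positions are counted from `0`). -/
noncomputable def rank (i j : Fin n) : ℕ :=
  ((N.graph.neighborFinset i).filter (fun l => N.port i l < N.port i j)).card

theorem rank_lt (i : Fin n) (j : N.Nbr i) : N.rank i j.1 < N.deg i := by
  classical
  unfold rank deg
  rw [← SimpleGraph.card_neighborFinset_eq_degree]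
  have h : (N.graph.neighborFinset i).filter (fun l => N.port i l < N.port i j.1) ⊂
      N.graph.neighborFinset i :=
    (Finset.filter_ssubset).2 ⟨j.1, by simpa using j.2, lt_irrefl _⟩
  convert Finset.card_lt_card h

theorem rank_lt_rank (i : Fin n) (j k : N.Nbr i) (h : N.port i j.1 < N.port i k.1) :
    N.rank i j.1 < N.rank i k.1 := by
  classical
  unfold rank
  apply Finset.card_lt_card
  rw [Finset.ssubset_iff_of_subset]
  · refine ⟨j.1, ?_, ?_⟩
    · simp only [Finset.mem_filter, SimpleGraph.mem_neighborFinset]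
      exact ⟨j.2, h⟩
    · simp
  · intro l hl
    simp only [Finset.mem_filter] at hl ⊢
    exact ⟨hl.1, hl.2.trans h⟩

theorem rank_bijective (i : Fin n) :
    Function.Bijective (fun j : N.Nbr i => (⟨N.rank i j.1, N.rank_lt i j⟩ : Fin (N.deg i))) := by
  classical
  rw [Fintype.bijective_iff_injective_and_card]
  constructor
  · intro j k h
    have h' : N.rank i j.1 = N.rank i k.1 := congrArg Fin.val h
    rcases lt_trichotomy (N.port i j.1) (N.port i k.1) with hlt | heq | hgt
    · exact absurd h' (N.rank_lt_rank i j k hlt).ne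
    · exact Subtype.ext (N.port_inj i j.1 k.1 j.2 k.2 heq)
    · exact absurd h' (N.rank_lt_rank i k j hgt).ne'
  · rw [Fintype.card_fin]
    unfold deg
    rw [← SimpleGraph.card_neighborSet_eq_degree]
    exact Fintype.card_congr (Equiv.refl _)

/-- The enumeration of the neighbors of `i` according to the port numbers: `N.slot i j` is the
index of neighbor `j`, and `(N.slot i).symm k` is the neighbor at the other end of the
`k`-th outgoing edge of `i`. -/
noncomputable def slot (i : Fin n) : N.Nbr i ≃ Fin (N.deg i) :=
  Equiv.ofBijective _ (N.rank_bijective i)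

end Network

/-! ### Algorithms and their execution -/

/-- An algorithm with input set `{0, ..., K}` and output set `Y`: for every degree `d`, a finite
automaton with internal memory set `Z d`, communicating through messages from the finite set `M`.
The elements `z₀ d` and `m₀` are the initial (special) memory state and message.
The initial value `x` of a node is read by the transition law and is never changed. -/
structure Algorithm (K : ℕ) (Y : Type*) where
  Z : ℕ → Type
  M : Type
  finite_Z : ∀ d, Finite (Z d)
  finite_M : Finite M
  z₀ : ∀ d, Z d
  m₀ : M
  step : ∀ d, Fin (K + 1) → Z d → Y → (Fin d → M) → Z d × Y × (Fin d → M)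

/-- The variable part of the state of a node of degree `d`: internal memory, output and the
outgoing messages, one for each outgoing edge. -/
structure NodeState {K : ℕ} {Y : Type*} (A : Algorithm K Y) (d : ℕ) where
  z : A.Z d
  y : Y
  m : Fin d → A.M

namespace Algorithm

variable {K : ℕ} {Y : Type*} (A : Algorithm K Y) {n : ℕ} (N : Network n)

/-- The message that node `i` receives through its `k`-th port, when the current states are `S`:
the neighbor `j` at the other end of the `k`-th edge of `i` has placed it into the port that leads
from `j` to `i`. -/
noncomputable def incoming (S : ∀ i, NodeState A (N.deg i)) (i : Fin n) (k : Fin (N.deg i)) : A.M :=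
  let j : N.Nbr i := (N.slot i).symm k
  (S j.1).m (N.slot j.1 ⟨i, j.2.symm⟩)

/-- The states of all nodes at time `t`, for the initial values `x`; at time `0` every output is
the special element `y₀` of `Y`, every memory is `z₀` and every message is `m₀`. -/
noncomputable def run (y₀ : Y) (x : Fin n → Fin (K + 1)) : ℕ → ∀ i, NodeState A (N.deg i)
  | 0 => fun i => ⟨A.z₀ (N.deg i), y₀, fun _ => A.m₀⟩
  | t + 1 => fun i =>
      let S := run y₀ x t
      let r := A.step (N.deg i) (x i) (S i).z (S i).y (A.incoming N S i)
      ⟨r.1, r.2.1, r.2.2⟩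

/-- The algorithm terminates with final output `y`: from some time on, all outputs equal `y`. -/
def TerminatesWith (y₀ : Y) (x : Fin n → Fin (K + 1)) (y : Y) : Prop :=
  ∃ t' : ℕ, ∀ i : Fin n, ∀ t ≥ t', (A.run N y₀ x t i).y = y

end Algorithm

/-! ### Computability -/

/-- The function family `(f n)` is computable: a single algorithm computes `f n` on every network
with `n` nodes, for every `n`, every port labeling and all initial values. (There is no network
with `n = 0`, so `f 0` is irrelevant.) -/
def FamilyComputable {K : ℕ} {Y : Type*} (y₀ : Y)
    (f : ∀ n : ℕ, (Fin n → Fin (K + 1)) → Y) : Prop :=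
  ∃ A : Algorithm K Y, ∀ (n : ℕ) (N : Network n) (x : Fin n → Fin (K + 1)),
    A.TerminatesWith N y₀ x (f n x)

/-- The frequency of occurrence of the initial value `k` in `x`. -/
noncomputable def freq {K n : ℕ} (x : Fin n → Fin (K + 1)) (k : Fin (K + 1)) : ℝ :=
  ((Finset.univ.filter (fun i => x i = k)).card : ℝ) / n

theorem freq_mem {K n : ℕ} (hn : 0 < n) (x : Fin n → Fin (K + 1)) :
    freq x ∈ stdSimplex ℝ (Fin (K + 1)) := by
  refine ⟨fun k => by unfold freq; positivity, ?_⟩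
  have hn' : (n : ℝ) ≠ 0 := by positivity
  unfold freq
  rw [← Finset.sum_div, ← Nat.cast_sum,
    ← Finset.card_eq_sum_card_fiberwise (f := x) (fun _ _ => Finset.mem_univ _)]
  simp [hn']

/-- The function `h` on the unit simplex corresponds to the function family `(f n)`, `n ≥ 1`. -/
def Corresponds {K : ℕ} {Y : Type*} (h : stdSimplex ℝ (Fin (K + 1)) → Y)
    (f : ∀ n : ℕ, (Fin n → Fin (K + 1)) → Y) : Prop :=
  ∀ (n : ℕ) (hn : 0 < n) (x : Fin n → Fin (K + 1)), f n x = h ⟨freq x, freq_mem hn x⟩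

/-- A function on the unit simplex is computable if it corresponds to a computable family. -/
def SimplexComputable {K : ℕ} {Y : Type*} (y₀ : Y) (h : stdSimplex ℝ (Fin (K + 1)) → Y) : Prop :=
  ∃ f : ∀ n : ℕ, (Fin n → Fin (K + 1)) → Y, Corresponds h f ∧ FamilyComputable y₀ f

/-! ### Sets defined by rational linear inequalities -/

/-- A linear inequality `∑ k, coeff k * p k ≤ bound` (or `<`, if `strict`) with rational data. -/
structure LinIneq (K : ℕ) where
  coeff : Fin (K + 1) → ℚ
  bound : ℚ
  strict : Bool

/-- The points of the simplex that satisfy the inequality. -/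
def LinIneq.solutions {K : ℕ} (c : LinIneq K) : Set (stdSimplex ℝ (Fin (K + 1))) :=
  {p | if c.strict then ∑ k, (c.coeff k : ℝ) * p.1 k < (c.bound : ℝ)
    else ∑ k, (c.coeff k : ℝ) * p.1 k ≤ (c.bound : ℝ)}

/-- A finite intersection of rational linear inequalities (within the simplex). -/
def IsRationalCell {K : ℕ} (C : Set (stdSimplex ℝ (Fin (K + 1)))) : Prop :=
  ∃ T : Set (LinIneq K), T.Finite ∧ C = ⋂ c ∈ T, c.solutions

/-- A finite union of finite intersections of rational linear inequalities. -/
def IsFiniteUnionOfCells {K : ℕ} (L : Set (stdSimplex ℝ (Fin (K + 1)))) : Prop :=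
  ∃ F : Set (Set (stdSimplex ℝ (Fin (K + 1)))),
    F.Finite ∧ (∀ C ∈ F, IsRationalCell C) ∧ L = ⋃₀ F

/-- The level set of `h` at `y`. -/
def levelSet {K : ℕ} {Y : Type*} (h : stdSimplex ℝ (Fin (K + 1)) → Y) (y : Y) :
    Set (stdSimplex ℝ (Fin (K + 1))) :=
  {p | h p = y}

end AnonNet

/-! Since frequencies sum to one, an affine inequality can be made homogeneous, and after clearing
denominators it becomes a sign condition on an integer sum `∑ i, w (x i)`
(`LinIneq.exists_weights`). Finitely many such signs determine `h` (`exists_finite_determining`), so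
it suffices to decide each sign and to run the deciders in parallel (`Algorithm.combine`).

A sign is decided by chips with bounded counts at each node. Debts walk by rotors and cancel resting
credits. A rotor that is used infinitely often serves every port infinitely often, so on a connected
graph debts that never die out reach every node again and again (`frequently_occupied`). If the
total is negative, debts survive and keep setting outputs to `true`. Otherwise they die out, and
heralds born from cancellations must announce this by setting outputs to `false`.

The difficulty is that, with a negative total, heralds and debts might circulate forever without
meeting. Traps prevent this by holding a herald until a debt comes by. The invariant `sum_trap`,
traps = debts + removers, makes traps last exactly as long as needed: while debts remain there is a
trap, so all heralds perish (`eventually_her_eq_zero`); once the debts are gone, removers clear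
every trap (`eventually_trap_eq_zero`) and the heralds visit all nodes (`frequently_her`). -/

namespace AnonNet

open Filter

/-! ### Ports, the edge involution and signal counts. -/

namespace Network

variable {n : ℕ} (N : Network n)

/-- The other end of the edge from `i` to its neighbor `j`, as a port of `j`. -/
noncomputable def backPort (i : Fin n) (j : N.Nbr i) : Σ i, Fin (N.deg i) :=
  ⟨j.1, N.slot j.1 ⟨i, j.2.symm⟩⟩

/-- The port at the other end of the edge attached to a port. -/
noncomputable def opp (e : Σ i, Fin (N.deg i)) : Σ i, Fin (N.deg i) :=
  N.backPort e.1 ((N.slot e.1).symm e.2)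

theorem opp_slot (i : Fin n) (j : N.Nbr i) : N.opp ⟨i, N.slot i j⟩ = N.backPort i j := by
  simp [opp]

theorem opp_involutive : Function.Involutive N.opp := by
  rintro ⟨i, k⟩
  obtain ⟨j, rfl⟩ := (N.slot i).surjective k
  rw [opp_slot, backPort, opp_slot]
  rfl

/-- The number of ports of `i` through which a signal arrives. -/
noncomputable def arrivals (out : ∀ i, Fin (N.deg i) → Bool) (i : Fin n) : ℕ :=
  (Finset.univ.filter fun k : Fin (N.deg i) => out (N.opp ⟨i, k⟩).1 (N.opp ⟨i, k⟩).2 = true).card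

/-- The involution `opp` reindexes receiving ports by sending ports. All conservation laws for
moving chips rest on this. -/
theorem sum_arrivals (out : ∀ i, Fin (N.deg i) → Bool) :
    ∑ i, N.arrivals out i =
      ∑ i, (Finset.univ.filter fun k : Fin (N.deg i) => out i k = true).card := by
  simp only [arrivals, Finset.card_filter]
  rw [← Fintype.sum_sigma'
      (fun i k => if out (N.opp ⟨i, k⟩).1 (N.opp ⟨i, k⟩).2 = true then 1 else 0),
    ← Fintype.sum_sigma' (fun i k => if out i k = true then 1 else 0)]
  exact Equiv.sum_comp (Equiv.ofBijective _ N.opp_involutive.bijective)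
    (fun e => if out e.1 e.2 = true then 1 else 0)

theorem arrivals_pos (out : ∀ i, Fin (N.deg i) → Bool) {i : Fin n} (j : N.Nbr i)
    (h : out i (N.slot i j) = true) : 0 < N.arrivals out j.1 := by
  refine Finset.card_pos.2 ⟨N.slot j.1 ⟨i, j.2.symm⟩, ?_⟩
  simp only [Finset.mem_filter, Finset.mem_univ, true_and]
  rw [opp_slot]
  exact h

theorem arrivals_le (out : ∀ i, Fin (N.deg i) → Bool) (i : Fin n) :
    N.arrivals out i ≤ N.deg i :=
  (Finset.card_le_univ _).trans_eq (Fintype.card_fin _)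

end Network

/-! ### Rotors -/

/-- The cyclic distance from `r` to `q` among `d` ports. -/
def rotorDist (d r q : ℕ) : ℕ := if r ≤ q then q - r else q + d - r

/-- The rotor after the next `s` ports have been served. -/
def nextRotor (d r s : ℕ) : ℕ := if r + s < d then r + s else r + s - d

/-- A node with `c` chips and rotor `r` serves the next `c` ports (all of them if `d ≤ c`). -/
def sends (d r c : ℕ) (q : Fin d) : Bool := decide (rotorDist d r q < c)

/-- Cyclic distance from the rotor permutes the ports. The bound `max d 1` admits the rotor value
`0` at a node without ports. -/
theorem card_sends {d r : ℕ} (hr : r < max d 1) (c : ℕ) :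
    (Finset.univ.filter fun q : Fin d => sends d r c q = true).card = min c d := by
  have hlt (q : Fin d) : rotorDist d r q < d := by
    have := q.2
    unfold rotorDist
    split_ifs <;> omega
  have hinj : Function.Injective (fun q : Fin d => (⟨rotorDist d r q, hlt q⟩ : Fin d)) := by
    intro a b hab
    have ha := a.2
    have hb := b.2
    have hab' : rotorDist d r a = rotorDist d r b := congrArg Fin.val hab
    apply Fin.ext
    unfold rotorDist at hab'
    split_ifs at hab' <;> omega
  let e := Equiv.ofBijective _ (Finite.injective_iff_bijective.1 hinj)
  have h1 : (Finset.univ.filter fun q : Fin d => sends d r c q = true).card =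
      (Finset.univ.filter fun q : Fin d => (q : ℕ) < c).card := by
    refine Finset.card_equiv e fun q => ?_
    simp [sends, e]
  rw [h1]
  rcases le_total d c with hdc | hcd
  · rw [Finset.filter_true_of_mem fun q _ => q.2.trans_le hdc]
    simp [hdc]
  · rw [min_eq_left hcd, Fin.card_filter_val_lt, min_eq_right hcd]

theorem nextRotor_lt {d r : ℕ} (hr : r < max d 1) (c : ℕ) :
    nextRotor d r (min c d) < max d 1 := by
  unfold nextRotor
  split_ifs <;> omega

/-- A port that is not served comes closer to the rotor, by the number of chips sent. -/
theorem rotorDist_nextRotor {d r c q : ℕ} (hr : r < d) (hq : q < d) (h : c ≤ rotorDist d r q) :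
    rotorDist d (nextRotor d r (min c d)) q + c = rotorDist d r q := by
  unfold rotorDist nextRotor at *
  split_ifs at * <;> omega

/-- If a rotor-driven node has chips infinitely often, then every port is served infinitely
often. -/
theorem frequently_sends {d : ℕ} {r c : ℕ → ℕ} (hr : ∀ t, r t < max d 1)
    (hrot : ∀ t, r (t + 1) = nextRotor d (r t) (min (c t) d))
    (hc : ∃ᶠ t in atTop, 0 < c t) (q : Fin d) :
    ∃ᶠ t in atTop, sends d (r t) (c t) q = true := by
  have hq := q.2
  intro hev
  obtain ⟨T, hT⟩ := eventually_atTop.1 hev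
  -- If `q` is never served again, its distance from the rotor drops by the number of chips at every
  -- step, which cannot go on forever.
  have hstep : ∀ t ≥ T, rotorDist d (r (t + 1)) q + c t = rotorDist d (r t) q := fun t ht => by
    rw [hrot t]
    have h2 := hT t ht
    simp only [sends, decide_eq_true_eq, not_lt] at h2
    have := hr t
    exact rotorDist_nextRotor (by omega) hq h2
  have hanti : ∀ a b, T ≤ a → a ≤ b → rotorDist d (r b) q ≤ rotorDist d (r a) q := by
    intro a b ha hab
    induction b, hab using Nat.le_induction with
    | base => exact le_rfl
    | succ b hb ih => have := hstep b (ha.trans hb); omega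
  have key : ∀ m, ∃ t ≥ T, rotorDist d (r t) q + m ≤ rotorDist d (r T) q := by
    intro m
    induction m with
    | zero => exact ⟨T, le_rfl, le_rfl⟩
    | succ m ih =>
      obtain ⟨t, ht, h⟩ := ih
      obtain ⟨u, hu, hcu⟩ := frequently_atTop.1 hc t
      have h1 := hstep u (ht.trans hu)
      have h2 := hanti t u ht hu
      exact ⟨u + 1, by omega, by omega⟩
  obtain ⟨t, _, h⟩ := key (rotorDist d (r T) q + 1)
  omega

/-- Chips that are moved by rotors visit every node infinitely often, unless they visit
infinitely often some node that is allowed to hold them. -/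
theorem frequently_occupied {n : ℕ} (N : Network n) {r c : ℕ → Fin n → ℕ}
    (hr : ∀ t i, r t i < max (N.deg i) 1)
    (hrot : ∀ t i, r (t + 1) i = nextRotor (N.deg i) (r t i) (min (c t i) (N.deg i)))
    {occ : ℕ → Fin n → Prop} {free : Fin n → Prop} {T : ℕ}
    (hsend : ∀ t ≥ T, ∀ i, free i → occ t i → 0 < c t i)
    (harr : ∀ t ≥ T, ∀ i,
      0 < N.arrivals (fun j => sends (N.deg j) (r t j) (c t j)) i → occ (t + 1) i)
    (hex : ∀ t ≥ T, ∃ i, occ t i) :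
    (∀ i, ∃ᶠ t in atTop, occ t i) ∨ ∃ i, ¬ free i ∧ ∃ᶠ t in atTop, occ t i := by
  -- Pigeonhole over the finitely many nodes; recurrence then spreads along edges.
  have h0 : ∃ i, ∃ᶠ t in atTop, occ t i := by
    by_contra hcon
    simp only [not_exists, not_frequently] at hcon
    obtain ⟨t, ht, htT⟩ := ((eventually_all.2 hcon).and (eventually_ge_atTop T)).exists
    obtain ⟨i, hi⟩ := hex t htT
    exact ht i hi
  by_cases hfree : ∃ i, ¬ free i ∧ ∃ᶠ t in atTop, occ t i
  · exact Or.inr hfree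
  left
  push Not at hfree
  obtain ⟨i₀, hi₀⟩ := h0
  have hadj : ∀ i j, N.graph.Adj i j → (∃ᶠ t in atTop, occ t i) → ∃ᶠ t in atTop, occ t j := by
    intro i j hij hi
    have hfi : free i := by
      by_contra hf
      exact hi (hfree i hf)
    have hci : ∃ᶠ t in atTop, 0 < c t i :=
      (hi.and_eventually (eventually_ge_atTop T)).mono fun t ht => hsend t ht.2 i hfi ht.1
    have hs := frequently_sends (fun t => hr t i) (fun t => hrot t i) hci (N.slot i ⟨j, hij⟩)
    rw [frequently_atTop]
    intro a
    obtain ⟨t, ht, hst⟩ := frequently_atTop.1 hs (max a T)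
    exact ⟨t + 1, by omega, harr t (by omega) j
      (N.arrivals_pos (fun j => sends (N.deg j) (r t j) (c t j)) ⟨j, hij⟩ hst)⟩
  intro j
  obtain ⟨p⟩ := N.connected.preconnected i₀ j
  induction p with
  | nil => exact hi₀
  | cons hij _ ih => exact ih (hadj _ _ hij hi₀)

/-- An antitone sequence in a well-founded order is eventually constant. -/
theorem eventually_const_of_antitone {α : Type*} [PartialOrder α] [WellFoundedLT α] {f : ℕ → α}
    (hf : Antitone f) : ∃ T, ∀ t ≥ T, f t = f T := by
  obtain ⟨_, ⟨T, rfl⟩, hT⟩ := wellFounded_lt.has_min (Set.range f) ⟨_, 0, rfl⟩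
  exact ⟨T, fun t ht => (hf ht).eq_of_not_lt (hT _ ⟨t, rfl⟩)⟩

/-! ### The chip dynamics -/

/-- The chips at a node. Debts `neg` move along and cancel the immobile credits `pos`; each debt
comes with an immobile trap. A cancelled debt turns into a remover `rem`, which moves until it
removes a trap, and produces a herald `her` (at most one is kept per node), which moves until it
is held by a trap, and is destroyed by a debt. -/
@[ext]
structure Chips where
  neg : ℕ
  pos : ℕ
  rem : ℕ
  trap : ℕ
  her : ℕ
  negRotor : ℕ
  remRotor : ℕ
  herRotor : ℕ

namespace Chips

/-- The heralds that are not held by a trap. -/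
def free (s : Chips) : ℕ := if s.trap = 0 then s.her else 0

/-- The initial chips of a node with value `v`. -/
def init (v : ℤ) : Chips := ⟨(-v).toNat, v.toNat, 0, (-v).toNat, 0, 0, 0, 0⟩

/-- The number of debts present after the moves of a step. -/
def movedNeg (d a : ℕ) (s : Chips) : ℕ := s.neg - min s.neg d + a

/-- The number of debts that are cancelled in a step. -/
def cancelled (d a : ℕ) (s : Chips) : ℕ := min (s.movedNeg d a) s.pos

/-- The number of removers present after the moves and the cancellations of a step. -/
def movedRem (d a b : ℕ) (s : Chips) : ℕ := s.rem - min s.rem d + b + s.cancelled d a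

/-- The number of heralds present after the moves of a step. -/
def movedHer (d c : ℕ) (s : Chips) : ℕ := s.her - min s.free d + c

/-- One step at a node of degree `d` at which `a` debts, `b` removers and `c` heralds arrive. -/
def advance (d a b c : ℕ) (s : Chips) : Chips where
  neg := s.movedNeg d a - s.cancelled d a
  pos := s.pos - s.cancelled d a
  rem := s.movedRem d a b - min (s.movedRem d a b) s.trap
  trap := s.trap - min (s.movedRem d a b) s.trap
  her := if 0 < s.movedNeg d a - s.cancelled d a then 0
    else min 1 (s.movedHer d c + s.cancelled d a)
  negRotor := nextRotor d s.negRotor (min s.neg d)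
  remRotor := nextRotor d s.remRotor (min s.rem d)
  herRotor := nextRotor d s.herRotor (min s.free d)

/-- The bounds on the chips of a node of degree `d` whose initial value is at most `B`. -/
structure Bounded (B d : ℕ) (s : Chips) : Prop where
  neg_le : s.neg ≤ B + d
  pos_le : s.pos ≤ B
  rem_le : s.rem + s.pos ≤ B + d
  trap_le : s.trap ≤ B
  her_le : s.her ≤ 1
  negRotor_lt : s.negRotor < max d 1
  remRotor_lt : s.remRotor < max d 1
  herRotor_lt : s.herRotor < max d 1

theorem bounded_init {B : ℕ} (d : ℕ) {v : ℤ} (hv : v.natAbs ≤ B) : Bounded B d (init v) := by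
  constructor <;> simp only [init] <;> omega

/-- A pile of at least `d` chips sends `d` and receives at most `d`; a smaller pile is emptied. A
cancellation turns a credit into a remover, so it is `rem + pos` that has an inductive bound. -/
theorem Bounded.advance {B d a b c : ℕ} {s : Chips} (h : Bounded B d s) (ha : a ≤ d)
    (hb : b ≤ d) : Bounded B d (advance d a b c s) := by
  obtain ⟨h1, h2, h3, h4, h5, h6, h7, h8⟩ := h
  constructor
  case negRotor_lt => exact nextRotor_lt h6 _
  case remRotor_lt => exact nextRotor_lt h7 _
  case herRotor_lt => exact nextRotor_lt h8 _
  case her_le => simp only [Chips.advance]; split_ifs <;> omega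
  all_goals simp only [Chips.advance, movedRem, cancelled, movedNeg]; omega

theorem finite_bounded (B d : ℕ) : Finite {s : Chips // Bounded B d s} := by
  have key (s : {s : Chips // Bounded B d s}) : s.1.neg < B + d + 2 ∧ s.1.pos < B + d + 2 ∧
      s.1.rem < B + d + 2 ∧ s.1.trap < B + d + 2 ∧ s.1.her < B + d + 2 ∧
      s.1.negRotor < B + d + 2 ∧ s.1.remRotor < B + d + 2 ∧ s.1.herRotor < B + d + 2 := by
    obtain ⟨s, h1, h2, h3, h4, h5, h6, h7, h8⟩ := s
    dsimp only
    omega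
  let f : {s : Chips // Bounded B d s} →
      Fin (B + d + 2) × Fin (B + d + 2) × Fin (B + d + 2) × Fin (B + d + 2) ×
      Fin (B + d + 2) × Fin (B + d + 2) × Fin (B + d + 2) × Fin (B + d + 2) := fun s =>
    (⟨_, (key s).1⟩, ⟨_, (key s).2.1⟩, ⟨_, (key s).2.2.1⟩, ⟨_, (key s).2.2.2.1⟩,
      ⟨_, (key s).2.2.2.2.1⟩, ⟨_, (key s).2.2.2.2.2.1⟩, ⟨_, (key s).2.2.2.2.2.2.1⟩,
      ⟨_, (key s).2.2.2.2.2.2.2⟩)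
  refine Finite.of_injective f fun s s' h => ?_
  simp only [f, Prod.mk.injEq, Fin.mk.injEq] at h
  obtain ⟨h1, h2, h3, h4, h5, h6, h7, h8⟩ := h
  exact Subtype.ext (Chips.ext h1 h2 h3 h4 h5 h6 h7 h8)

/-- Whether a debt, a remover, a herald leaves through the port `q`. -/
def emit (d : ℕ) (s : Chips) (q : Fin d) : Bool × Bool × Bool :=
  (sends d s.negRotor s.neg q, sends d s.remRotor s.rem q, sends d s.herRotor s.free q)

end Chips

variable {n : ℕ}

/-- The chips of all nodes after `t` steps, for the initial values `v`. -/
noncomputable def chips (N : Network n) (v : Fin n → ℤ) : ℕ → Fin n → Chips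
  | 0, i => Chips.init (v i)
  | t + 1, i => (chips N v t i).advance (N.deg i)
      (N.arrivals (fun j q => ((chips N v t j).emit (N.deg j) q).1) i)
      (N.arrivals (fun j q => ((chips N v t j).emit (N.deg j) q).2.1) i)
      (N.arrivals (fun j q => ((chips N v t j).emit (N.deg j) q).2.2) i)

section Dynamics

variable (N : Network n) (v : Fin n → ℤ)

/-- The number of debts that arrive at `i` in step `t`. -/
noncomputable def negIn (t : ℕ) (i : Fin n) : ℕ :=
  N.arrivals (fun j => sends (N.deg j) (chips N v t j).negRotor (chips N v t j).neg) i

/-- The number of removers that arrive at `i` in step `t`. -/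
noncomputable def remIn (t : ℕ) (i : Fin n) : ℕ :=
  N.arrivals (fun j => sends (N.deg j) (chips N v t j).remRotor (chips N v t j).rem) i

/-- The number of heralds that arrive at `i` in step `t`. -/
noncomputable def herIn (t : ℕ) (i : Fin n) : ℕ :=
  N.arrivals (fun j => sends (N.deg j) (chips N v t j).herRotor (chips N v t j).free) i

theorem chips_succ (t : ℕ) (i : Fin n) : chips N v (t + 1) i =
    (chips N v t i).advance (N.deg i) (negIn N v t i) (remIn N v t i) (herIn N v t i) := rfl

theorem chips_bounded {B : ℕ} (hB : ∀ i, (v i).natAbs ≤ B) (t : ℕ) (i : Fin n) :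
    (chips N v t i).Bounded B (N.deg i) := by
  induction t with
  | zero => exact Chips.bounded_init _ (hB i)
  | succ t ih => exact ih.advance (N.arrivals_le _ _) (N.arrivals_le _ _)

theorem exists_chips_bounded (t : ℕ) (i : Fin n) :
    ∃ B, (chips N v t i).Bounded B (N.deg i) :=
  ⟨_, chips_bounded N v
    (fun i => Finset.single_le_sum (f := fun i => (v i).natAbs) (fun _ _ => Nat.zero_le _)
      (Finset.mem_univ i)) t i⟩

theorem negRotor_lt (t : ℕ) (i : Fin n) : (chips N v t i).negRotor < max (N.deg i) 1 :=
  (exists_chips_bounded N v t i).choose_spec.negRotor_lt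

theorem remRotor_lt (t : ℕ) (i : Fin n) : (chips N v t i).remRotor < max (N.deg i) 1 :=
  (exists_chips_bounded N v t i).choose_spec.remRotor_lt

theorem herRotor_lt (t : ℕ) (i : Fin n) : (chips N v t i).herRotor < max (N.deg i) 1 :=
  (exists_chips_bounded N v t i).choose_spec.herRotor_lt

theorem sum_negIn (t : ℕ) :
    ∑ i, negIn N v t i = ∑ i, min (chips N v t i).neg (N.deg i) := by
  unfold negIn
  rw [N.sum_arrivals]
  exact Finset.sum_congr rfl fun i _ => card_sends (negRotor_lt N v t i) _

theorem sum_remIn (t : ℕ) :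
    ∑ i, remIn N v t i = ∑ i, min (chips N v t i).rem (N.deg i) := by
  unfold remIn
  rw [N.sum_arrivals]
  exact Finset.sum_congr rfl fun i _ => card_sends (remRotor_lt N v t i) _

theorem sum_herIn (t : ℕ) :
    ∑ i, herIn N v t i = ∑ i, min (chips N v t i).free (N.deg i) := by
  unfold herIn
  rw [N.sum_arrivals]
  exact Finset.sum_congr rfl fun i _ => card_sends (herRotor_lt N v t i) _

/-! ### Conserved quantities -/

/-- Moves preserve the number of debts, and a cancellation uses up one debt and one credit. -/
theorem sum_neg_sub_sum_pos (t : ℕ) :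
    (∑ i, ((chips N v t i).neg : ℤ)) - ∑ i, ((chips N v t i).pos : ℤ) = - ∑ i, v i := by
  induction t with
  | zero =>
    rw [← Finset.sum_sub_distrib, ← Finset.sum_neg_distrib]
    refine Finset.sum_congr rfl fun i _ => ?_
    simp only [chips, Chips.init]
    omega
  | succ t ih =>
    -- The balance at each node is written without subtraction, so that it can be summed in `ℕ`.
    have h : ∑ i, ((chips N v (t + 1) i).neg + (chips N v t i).pos +
        min (chips N v t i).neg (N.deg i)) =
        ∑ i, ((chips N v t i).neg + (chips N v (t + 1) i).pos + negIn N v t i) := by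
      refine Finset.sum_congr rfl fun i _ => ?_
      simp only [chips_succ, Chips.advance, Chips.cancelled, Chips.movedNeg]
      omega
    simp only [Finset.sum_add_distrib, sum_negIn] at h
    zify at h
    linarith

/-- Debts and traps start in equal numbers, a cancelled debt becomes a remover, and a remover
vanishes together with a trap. -/
theorem sum_trap (t : ℕ) : ∑ i, (chips N v t i).trap =
    ∑ i, (chips N v t i).neg + ∑ i, (chips N v t i).rem := by
  induction t with
  | zero => simp [chips, Chips.init]
  | succ t ih =>
    have h : ∑ i, ((chips N v (t + 1) i).neg + (chips N v (t + 1) i).rem +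
        min (chips N v t i).neg (N.deg i) + min (chips N v t i).rem (N.deg i) +
        (chips N v t i).trap) =
        ∑ i, ((chips N v t i).neg + (chips N v t i).rem + negIn N v t i + remIn N v t i +
        (chips N v (t + 1) i).trap) := by
      refine Finset.sum_congr rfl fun i _ => ?_
      simp only [chips_succ, Chips.advance, Chips.movedRem, Chips.cancelled, Chips.movedNeg]
      omega
    simp only [Finset.sum_add_distrib, sum_negIn, sum_remIn] at h
    omega

theorem antitone_pos : Antitone fun t i => (chips N v t i).pos :=
  antitone_nat_of_succ_le fun _ _ => Nat.sub_le _ _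

theorem antitone_trap : Antitone fun t i => (chips N v t i).trap :=
  antitone_nat_of_succ_le fun _ _ => Nat.sub_le _ _

/-- From some time on, nothing is cancelled and no trap is removed. -/
theorem exists_stable : ∃ T, ∀ t ≥ T, ∀ i,
    (chips N v t i).pos = (chips N v T i).pos ∧ (chips N v t i).trap = (chips N v T i).trap ∧
    (chips N v t i).cancelled (N.deg i) (negIn N v t i) = 0 ∧
    min ((chips N v t i).movedRem (N.deg i) (negIn N v t i) (remIn N v t i))
      (chips N v t i).trap = 0 := by
  obtain ⟨T₁, h₁⟩ := eventually_const_of_antitone (antitone_pos N v)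
  obtain ⟨T₂, h₂⟩ := eventually_const_of_antitone (antitone_trap N v)
  have hp : ∀ t ≥ max T₁ T₂, ∀ i, (chips N v t i).pos = (chips N v T₁ i).pos :=
    fun t ht i => congrFun (h₁ t (by omega)) i
  have hq : ∀ t ≥ max T₁ T₂, ∀ i, (chips N v t i).trap = (chips N v T₂ i).trap :=
    fun t ht i => congrFun (h₂ t (by omega)) i
  refine ⟨max T₁ T₂, fun t ht i => ⟨?_, ?_, ?_, ?_⟩⟩
  · rw [hp t ht, hp _ le_rfl]
  · rw [hq t ht, hq _ le_rfl]
  · have h : (chips N v (t + 1) i).pos = (chips N v t i).pos := by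
      rw [hp t ht, hp (t + 1) (by omega)]
    simp only [chips_succ, Chips.advance] at h
    have : (chips N v t i).cancelled (N.deg i) (negIn N v t i) ≤ (chips N v t i).pos :=
      min_le_right _ _
    omega
  · have h : (chips N v (t + 1) i).trap = (chips N v t i).trap := by
      rw [hq t ht, hq (t + 1) (by omega)]
    simp only [chips_succ, Chips.advance] at h
    omega

/-! ### Recurrence of debts and removers. -/

/-- If there are debts forever, they visit every node infinitely often. -/
theorem frequently_neg (h : ∀ t, 0 < ∑ i, (chips N v t i).neg) (i : Fin n) :
    ∃ᶠ t in atTop, 0 < (chips N v t i).neg := by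
  obtain ⟨T, hT⟩ := exists_stable N v
  refine ((frequently_occupied N (r := fun t i => (chips N v t i).negRotor)
    (c := fun t i => (chips N v t i).neg) (occ := fun t i => 0 < (chips N v t i).neg)
    (free := fun _ => True) (T := T) (negRotor_lt N v) (fun _ _ => rfl) (fun _ _ _ _ h => h)
    (fun t ht i hi => ?_) (fun t _ => ?_)).resolve_right fun ⟨_, hi, _⟩ => hi trivial) i
  · have h0 := (hT t ht i).2.2.1
    change 0 < negIn N v t i at hi
    simp only [chips_succ, Chips.advance]
    rw [h0]
    simp only [Chips.movedNeg]
    omega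
  · obtain ⟨i, _, hi⟩ := Finset.sum_pos_iff.1 (h t)
    exact ⟨i, hi⟩

/-- If there are removers from some time on, they visit every node infinitely often. -/
theorem frequently_rem {T₀ : ℕ} (h : ∀ t ≥ T₀, 0 < ∑ i, (chips N v t i).rem) (i : Fin n) :
    ∃ᶠ t in atTop, 0 < (chips N v t i).rem := by
  obtain ⟨T, hT⟩ := exists_stable N v
  refine ((frequently_occupied N (r := fun t i => (chips N v t i).remRotor)
    (c := fun t i => (chips N v t i).rem) (occ := fun t i => 0 < (chips N v t i).rem)
    (free := fun _ => True) (T := max T T₀) (remRotor_lt N v) (fun _ _ => rfl)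
    (fun _ _ _ _ h => h) (fun t ht i hi => ?_) (fun t ht => ?_)).resolve_right
      fun ⟨_, hi, _⟩ => hi trivial) i
  · have h0 := (hT t (by omega) i).2.2.2
    change 0 < remIn N v t i at hi
    simp only [chips_succ, Chips.advance]
    rw [h0]
    simp only [Chips.movedRem]
    omega
  · obtain ⟨i, _, hi⟩ := Finset.sum_pos_iff.1 (h t (by omega))
    exact ⟨i, hi⟩

theorem her_eq_zero_of_neg_pos {t : ℕ} {i : Fin n} (h : 0 < (chips N v t i).neg) :
    (chips N v t i).her = 0 := by
  cases t with
  | zero => rfl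
  | succ t => exact if_pos h

/-- Heralds that are not destroyed or merged are conserved. -/
theorem sum_movedHer (t : ℕ) :
    ∑ i, (chips N v t i).movedHer (N.deg i) (herIn N v t i) = ∑ i, (chips N v t i).her := by
  have h : ∑ i, ((chips N v t i).movedHer (N.deg i) (herIn N v t i) +
      min (chips N v t i).free (N.deg i)) =
      ∑ i, ((chips N v t i).her + herIn N v t i) := by
    refine Finset.sum_congr rfl fun i _ => ?_
    simp only [Chips.movedHer, Chips.free]
    split_ifs <;> omega
  simp only [Finset.sum_add_distrib, sum_herIn] at h
  omega

/-! ### Negative total -/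

theorem neg_pos_of_sum_neg (hv : ∑ i, v i < 0) (t : ℕ) : 0 < ∑ i, (chips N v t i).neg := by
  have h := sum_neg_sub_sum_pos N v t
  have : (0 : ℤ) ≤ ∑ i, ((chips N v t i).pos : ℤ) := Finset.sum_nonneg fun _ _ => by omega
  zify
  omega

/-- If the total is negative, all heralds disappear. -/
theorem eventually_her_eq_zero (hv : ∑ i, v i < 0) :
    ∀ᶠ t in atTop, ∀ i, (chips N v t i).her = 0 := by
  obtain ⟨T, hT⟩ := exists_stable N v
  -- After `T` no cancellation creates heralds, so their total decreases to a constant; from then on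
  -- none is destroyed or merged.
  have hle : ∀ t ≥ T, ∀ i, (chips N v (t + 1) i).her ≤
      (chips N v t i).movedHer (N.deg i) (herIn N v t i) := fun t ht i => by
    have h0 := (hT t ht i).2.2.1
    simp only [chips_succ, Chips.advance, h0]
    split_ifs <;> omega
  have hanti : Antitone fun t => ∑ i, (chips N v (T + t) i).her :=
    antitone_nat_of_succ_le fun t =>
      (Finset.sum_le_sum fun i _ => hle (T + t) (by omega) i).trans_eq (sum_movedHer N v (T + t))
  obtain ⟨T₁, hT₁⟩ := eventually_const_of_antitone hanti
  have hconst : ∀ t ≥ T + T₁,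
      ∑ i, (chips N v t i).her = ∑ i, (chips N v (T + T₁) i).her := fun t ht => by
    have := hT₁ (t - T) (by omega)
    rwa [show T + (t - T) = t by omega] at this
  have heq : ∀ t ≥ T + T₁, ∀ i, (chips N v (t + 1) i).her =
      (chips N v t i).movedHer (N.deg i) (herIn N v t i) := fun t ht i => by
    refine (Finset.sum_eq_sum_iff_of_le fun i _ => hle t (by omega) i).1 ?_ i (Finset.mem_univ i)
    rw [sum_movedHer, hconst t ht, hconst (t + 1) (by omega)]
  by_cases hz : ∑ i, (chips N v (T + T₁) i).her = 0
  · filter_upwards [eventually_ge_atTop (T + T₁)] with t ht i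
    exact Finset.sum_eq_zero_iff.1 ((hconst t ht).trans hz) i (Finset.mem_univ i)
  exfalso
  -- Either heralds recur at a trap, or they recur everywhere, and some trap exists because debts
  -- do. A herald held there is later met by a debt, a contradiction.
  have hnode : ∃ i, 0 < (chips N v T i).trap ∧ ∃ᶠ t in atTop, 0 < (chips N v t i).her := by
    refine (frequently_occupied N (r := fun t i => (chips N v t i).herRotor)
      (c := fun t i => (chips N v t i).free) (occ := fun t i => 0 < (chips N v t i).her)
      (free := fun i => (chips N v T i).trap = 0) (T := T + T₁) (herRotor_lt N v)
      (fun _ _ => rfl) (fun t ht i hi ho => ?_) (fun t ht i hi => ?_) (fun t ht => ?_)).elim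
      (fun h => ?_) fun ⟨i, hi, ho⟩ => ⟨i, Nat.pos_of_ne_zero hi, ho⟩
    · rw [← (hT t (by omega) i).2.1] at hi
      simpa [Chips.free, hi] using ho
    · change 0 < herIn N v t i at hi
      rw [heq t ht]
      simp only [Chips.movedHer]
      omega
    · have h1 : 0 < ∑ i, (chips N v t i).her := by rw [hconst t ht]; omega
      obtain ⟨i, _, hi⟩ := Finset.sum_pos_iff.1 h1
      exact ⟨i, hi⟩
    · have h1 : 0 < ∑ i, (chips N v T i).trap := by
        have := neg_pos_of_sum_neg N v hv T
        rw [sum_trap]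
        omega
      obtain ⟨i, _, hi⟩ := Finset.sum_pos_iff.1 h1
      exact ⟨i, hi, h i⟩
  obtain ⟨i, htrap, ho⟩ := hnode
  obtain ⟨t₀, ht₀, hh⟩ := frequently_atTop.1 ho (T + T₁)
  have hheld : ∀ t ≥ t₀, 0 < (chips N v t i).her := by
    intro t ht
    induction t, ht using Nat.le_induction with
    | base => exact hh
    | succ t ht ih =>
      have h1 : (chips N v t i).trap ≠ 0 := by
        rw [(hT t (by omega) i).2.1]
        omega
      rw [heq t (by omega)]
      simp only [Chips.movedHer, Chips.free, if_neg h1]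
      omega
  obtain ⟨t, ht, hn⟩ := frequently_atTop.1 (frequently_neg N v (neg_pos_of_sum_neg N v hv) i) t₀
  have := hheld t ht
  rw [her_eq_zero_of_neg_pos N v hn] at this
  exact lt_irrefl _ this

/-! ### Nonnegative total -/

/-- Surviving debts would force surviving credits, and a debt reaching a node with credits after
stabilization would still cancel one. -/
theorem exists_neg_eq_zero (hv : 0 ≤ ∑ i, v i) : ∃ t, ∑ i, (chips N v t i).neg = 0 := by
  by_contra hcon
  push Not at hcon
  have hpos : ∀ t, 0 < ∑ i, (chips N v t i).neg := fun t => Nat.pos_of_ne_zero (hcon t)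
  obtain ⟨T, hT⟩ := exists_stable N v
  have h1 : 0 < ∑ i, (chips N v T i).pos := by
    have h2 := sum_neg_sub_sum_pos N v T
    have h3 := hpos T
    zify at h3 ⊢
    omega
  obtain ⟨i, _, hi⟩ := Finset.sum_pos_iff.1 h1
  obtain ⟨t, ht, hn⟩ := frequently_atTop.1 (frequently_neg N v hpos i) (T + 1)
  obtain ⟨t, rfl⟩ : ∃ s, t = s + 1 := ⟨t - 1, by omega⟩
  have h4 := (hT t (by omega) i).2.2.1
  have h5 := (hT t (by omega) i).1
  simp only [chips_succ, Chips.advance] at hn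
  simp only [Chips.cancelled] at h4 hn
  omega

theorem antitone_sum_neg : Antitone fun t => ∑ i, (chips N v t i).neg := by
  refine antitone_nat_of_succ_le fun t => ?_
  have h1 := sum_neg_sub_sum_pos N v t
  have h2 := sum_neg_sub_sum_pos N v (t + 1)
  have h3 : ∑ i, (chips N v (t + 1) i).pos ≤ ∑ i, (chips N v t i).pos :=
    Finset.sum_le_sum fun i _ => antitone_pos N v (Nat.le_succ t) i
  zify at h3 ⊢
  omega

/-- If there are debts initially but not forever, then from some time on there are heralds and no
debts. -/
theorem exists_her (h0 : 0 < ∑ i, (chips N v 0 i).neg)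
    (h : ∃ t, ∑ i, (chips N v t i).neg = 0) :
    ∃ T, ∀ t ≥ T, ∑ i, (chips N v t i).neg = 0 ∧ 0 < ∑ i, (chips N v t i).her := by
  classical
  -- Step `T` cancels the last debts and so creates a herald; afterwards heralds can merge but not
  -- be destroyed.
  obtain ⟨T, hT⟩ : ∃ T, Nat.find h = T + 1 := by
    refine ⟨Nat.find h - 1, ?_⟩
    have h1 : Nat.find h ≠ 0 := fun h1 => by
      have := Nat.find_spec h
      rw [h1] at this
      omega
    omega
  have hzero : ∀ t ≥ T + 1, ∑ i, (chips N v t i).neg = 0 := fun t ht =>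
    Nat.eq_zero_of_le_zero ((antitone_sum_neg N v ht).trans_eq (hT ▸ Nat.find_spec h))
  have hzero' : ∀ t ≥ T + 1, ∀ i, (chips N v t i).neg = 0 := fun t ht i =>
    Finset.sum_eq_zero_iff.1 (hzero t ht) i (Finset.mem_univ i)
  have hher : ∀ t ≥ T, ∀ i, (chips N v (t + 1) i).her =
      min 1 ((chips N v t i).movedHer (N.deg i) (herIn N v t i) +
        (chips N v t i).cancelled (N.deg i) (negIn N v t i)) := fun t ht i => by
    have h1 := hzero' (t + 1) (by omega) i
    exact if_neg (by rw [chips_succ] at h1; exact h1.not_gt)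
  refine ⟨T + 1, fun t ht => ⟨hzero t ht, ?_⟩⟩
  induction t, ht using Nat.le_induction with
  | base =>
    have hpos : ∑ i, (chips N v T i).neg ≠ 0 := Nat.find_min h (by omega)
    have hmoved : ∑ i, (chips N v T i).movedNeg (N.deg i) (negIn N v T i) =
        ∑ i, (chips N v T i).neg := by
      have h2 : ∑ i, ((chips N v T i).movedNeg (N.deg i) (negIn N v T i) +
          min (chips N v T i).neg (N.deg i)) =
          ∑ i, ((chips N v T i).neg + negIn N v T i) := by
        refine Finset.sum_congr rfl fun i _ => ?_
        simp only [Chips.movedNeg]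
        omega
      simp only [Finset.sum_add_distrib, sum_negIn] at h2
      omega
    obtain ⟨i, _, hi⟩ := Finset.sum_pos_iff.1 (hmoved ▸ Nat.pos_of_ne_zero hpos)
    have h1 := hzero' (T + 1) le_rfl i
    simp only [chips_succ, Chips.advance] at h1
    refine Finset.sum_pos_iff.2 ⟨i, Finset.mem_univ i, ?_⟩
    rw [hher T le_rfl]
    omega
  | succ t ht ih =>
    rw [← sum_movedHer] at ih
    obtain ⟨i, _, hi⟩ := Finset.sum_pos_iff.1 ih
    refine Finset.sum_pos_iff.2 ⟨i, Finset.mem_univ i, ?_⟩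
    rw [hher t (by omega)]
    omega

/-- If the debts disappear, then so do the traps. -/
theorem eventually_trap_eq_zero (h : ∃ T, ∀ t ≥ T, ∑ i, (chips N v t i).neg = 0) :
    ∃ T, ∀ t ≥ T, ∀ i, (chips N v t i).trap = 0 := by
  obtain ⟨T₀, hT₀⟩ := h
  obtain ⟨T, hT⟩ := exists_stable N v
  by_cases hz : ∑ i, (chips N v (max T T₀) i).trap = 0
  · refine ⟨max T T₀, fun t ht i => ?_⟩
    have := Finset.sum_eq_zero_iff.1 hz i (Finset.mem_univ i)
    rwa [(hT _ (le_max_left _ _) i).2.1, ← (hT t (by omega) i).2.1] at this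
  exfalso
  obtain ⟨i, _, hi⟩ := Finset.sum_pos_iff.1 (Nat.pos_of_ne_zero hz)
  rw [(hT _ (le_max_left _ _) i).2.1] at hi
  have hrem : ∀ t ≥ max T T₀, 0 < ∑ i, (chips N v t i).rem := fun t ht => by
    have h1 := sum_trap N v t
    rw [hT₀ t (by omega), zero_add] at h1
    rw [← h1]
    exact Finset.sum_pos_iff.2 ⟨i, Finset.mem_univ i, by rwa [(hT t (by omega) i).2.1]⟩
  obtain ⟨t, ht, hn⟩ := frequently_atTop.1 (frequently_rem N v hrem i) (T + 1)
  obtain ⟨t, rfl⟩ : ∃ s, t = s + 1 := ⟨t - 1, by omega⟩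
  have h4 := (hT t (by omega) i).2.2.2
  have h5 := (hT t (by omega) i).2.1
  simp only [chips_succ, Chips.advance] at hn
  omega

/-- If there are heralds and no debts from some time on, then the heralds visit every node
infinitely often. -/
theorem frequently_her {T : ℕ}
    (h : ∀ t ≥ T, ∑ i, (chips N v t i).neg = 0 ∧ 0 < ∑ i, (chips N v t i).her) (i : Fin n) :
    ∃ᶠ t in atTop, 0 < (chips N v t i).her := by
  obtain ⟨T₁, hT₁⟩ := eventually_trap_eq_zero N v ⟨T, fun t ht => (h t ht).1⟩
  refine ((frequently_occupied N (r := fun t i => (chips N v t i).herRotor)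
    (c := fun t i => (chips N v t i).free) (occ := fun t i => 0 < (chips N v t i).her)
    (free := fun _ => True) (T := max T T₁) (herRotor_lt N v) (fun _ _ => rfl)
    (fun t ht i _ ho => ?_) (fun t ht i hi => ?_) (fun t ht => ?_)).resolve_right
      fun ⟨_, hi, _⟩ => hi trivial) i
  · simpa [Chips.free, hT₁ t (by omega) i] using ho
  · change 0 < herIn N v t i at hi
    have h1 := Finset.sum_eq_zero_iff.1 (h (t + 1) (by omega)).1 i (Finset.mem_univ i)
    simp only [chips_succ, Chips.advance] at h1 ⊢
    rw [if_neg h1.not_gt]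
    simp only [Chips.movedHer]
    omega
  · obtain ⟨i, _, hi⟩ := Finset.sum_pos_iff.1 (h t (by omega)).2
    exact ⟨i, hi⟩

end Dynamics

/-! ### Reading off the sign -/

/-- The output of a node with chips `s` whose previous output was `y`; the output `true` stands
for a negative total. -/
def Chips.readOut (s : Chips) (y : Bool) : Bool :=
  if 0 < s.neg then true else if 0 < s.her then false else y

/-- A sequence that is frequently set to `b`, and otherwise unchanged, is eventually `b`. -/
theorem eventually_eq_of_frequently_set {b : Bool} {y : ℕ → Bool}
    (hset : ∃ᶠ t in atTop, y t = b) (hkeep : ∀ᶠ t in atTop, y t = b → y (t + 1) = b) :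
    ∀ᶠ t in atTop, y t = b := by
  obtain ⟨T, hT⟩ := eventually_atTop.1 hkeep
  obtain ⟨t₀, ht₀, h₀⟩ := frequently_atTop.1 hset T
  filter_upwards [eventually_ge_atTop t₀] with t ht
  induction t, ht using Nat.le_induction with
  | base => exact h₀
  | succ t ht ih => exact hT t (by omega) ih

theorem eventually_readOut (N : Network n) (v : Fin n → ℤ) {i : Fin n} {y : ℕ → Bool}
    (h0 : y 0 = false) (hy : ∀ t, y (t + 1) = (chips N v t i).readOut (y t)) :
    ∀ᶠ t in atTop, y t = decide (∑ i, v i < 0) := by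
  by_cases hv : ∑ i, v i < 0
  · simp only [hv, decide_true]
    apply eventually_eq_of_frequently_set
    · refine frequently_atTop.2 fun a => ?_
      obtain ⟨t, ht, h⟩ :=
        frequently_atTop.1 (frequently_neg N v (neg_pos_of_sum_neg N v hv) i) a
      exact ⟨t + 1, by omega, by rw [hy, Chips.readOut, if_pos h]⟩
    · filter_upwards [eventually_her_eq_zero N v hv] with t ht h
      rw [hy, Chips.readOut, ht i]
      simp [h]
  · simp only [hv, decide_false]
    -- Without initial debts there is no cancellation to create a herald, and the initial output
    -- `false` has to be right already.
    by_cases hn : ∑ i, (chips N v 0 i).neg = 0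
    · have hneg : ∀ t, (chips N v t i).neg = 0 := fun t =>
        Finset.sum_eq_zero_iff.1
          (Nat.eq_zero_of_le_zero ((antitone_sum_neg N v (Nat.zero_le t)).trans_eq hn)) i
          (Finset.mem_univ i)
      refine Eventually.of_forall fun t => ?_
      induction t with
      | zero => exact h0
      | succ t ih => simp [hy, Chips.readOut, hneg, ih]
    · obtain ⟨T, hT⟩ := exists_her N v (Nat.pos_of_ne_zero hn)
        (exists_neg_eq_zero N v (not_lt.1 hv))
      have hneg : ∀ t ≥ T, (chips N v t i).neg = 0 := fun t ht =>
        Finset.sum_eq_zero_iff.1 (hT t ht).1 i (Finset.mem_univ i)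
      apply eventually_eq_of_frequently_set
      · refine frequently_atTop.2 fun a => ?_
        obtain ⟨t, ht, h⟩ := frequently_atTop.1 (frequently_her N v hT i) (max a T)
        exact ⟨t + 1, by omega, by simp [hy, Chips.readOut, hneg t (by omega), h]⟩
      · filter_upwards [eventually_ge_atTop T] with t ht h
        simp [hy, Chips.readOut, hneg t ht, h]

/-! ### Deciding one inequality -/

section SignAlgorithm

variable {K : ℕ} (w : Fin (K + 1) → ℤ)

/-- The next chips of a node with initial value `k` that receives the messages `m`. -/
def nextChips (d : ℕ) (k : Fin (K + 1))
    (z : Option {s : Chips // s.Bounded (∑ k, (w k).natAbs) d})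
    (m : Fin d → Bool × Bool × Bool) : {s : Chips // s.Bounded (∑ k, (w k).natAbs) d} :=
  match z with
  | none => ⟨Chips.init (w k), Chips.bounded_init d
      (Finset.single_le_sum (f := fun k => (w k).natAbs) (fun _ _ => Nat.zero_le _)
        (Finset.mem_univ k))⟩
  | some s => ⟨s.1.advance d
      (Finset.univ.filter fun q => (m q).1 = true).card
      (Finset.univ.filter fun q => (m q).2.1 = true).card
      (Finset.univ.filter fun q => (m q).2.2 = true).card,
      s.2.advance ((Finset.card_le_univ _).trans_eq (Fintype.card_fin d))
        ((Finset.card_le_univ _).trans_eq (Fintype.card_fin d))⟩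

/-- The algorithm that decides whether the sum of the weights of the initial values is
negative. -/
def signAlgorithm : Algorithm K Bool where
  Z d := Option {s : Chips // s.Bounded (∑ k, (w k).natAbs) d}
  M := Bool × Bool × Bool
  finite_Z d :=
    have := Chips.finite_bounded (∑ k, (w k).natAbs) d
    inferInstance
  finite_M := inferInstance
  z₀ _ := none
  m₀ := (false, false, false)
  step d k z y m :=
    (some (nextChips w d k z m), (nextChips w d k z m).1.readOut y, (nextChips w d k z m).1.emit d)

/-- The initial memory cannot depend on `x`, so the first step only loads the chips and the run lags
one step behind `chips`. -/
theorem signAlgorithm_run {n : ℕ} (N : Network n) (x : Fin n → Fin (K + 1)) (t : ℕ) :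
    ∀ i, (∃ h, ((signAlgorithm w).run N false x (t + 1) i).z =
        some ⟨chips N (fun i => w (x i)) t i, h⟩) ∧
      ((signAlgorithm w).run N false x (t + 1) i).m =
        (chips N (fun i => w (x i)) t i).emit (N.deg i) ∧
      ((signAlgorithm w).run N false x (t + 1) i).y =
        (chips N (fun i => w (x i)) t i).readOut ((signAlgorithm w).run N false x t i).y := by
  have step : ∀ t i, (nextChips w (N.deg i) (x i) ((signAlgorithm w).run N false x t i).z
        ((signAlgorithm w).incoming N ((signAlgorithm w).run N false x t) i)).1 =
          chips N (fun i => w (x i)) t i →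
      (∃ h, ((signAlgorithm w).run N false x (t + 1) i).z =
        some ⟨chips N (fun i => w (x i)) t i, h⟩) ∧
      ((signAlgorithm w).run N false x (t + 1) i).m =
        (chips N (fun i => w (x i)) t i).emit (N.deg i) ∧
      ((signAlgorithm w).run N false x (t + 1) i).y =
        (chips N (fun i => w (x i)) t i).readOut ((signAlgorithm w).run N false x t i).y := by
    intro t i h
    rw [← h]
    exact ⟨⟨Subtype.property _, rfl⟩, rfl, rfl⟩
  induction t with
  | zero => exact fun i => step 0 i rfl
  | succ t ih =>
    intro i
    apply step
    obtain ⟨⟨hb, hz⟩, -, -⟩ := ih i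
    have hm : (signAlgorithm w).incoming N ((signAlgorithm w).run N false x (t + 1)) i =
        fun k => (chips N (fun i => w (x i)) t (N.opp ⟨i, k⟩).1).emit _ (N.opp ⟨i, k⟩).2 := by
      funext k
      exact congrFun (ih (N.opp ⟨i, k⟩).1).2.1 (N.opp ⟨i, k⟩).2
    rw [hz, hm]
    rfl

theorem signAlgorithm_terminates {n : ℕ} (N : Network n) (x : Fin n → Fin (K + 1)) :
    (signAlgorithm w).TerminatesWith N false x (decide (∑ i, w (x i) < 0)) := by
  have h : ∀ᶠ t in atTop, ∀ i, ((signAlgorithm w).run N false x t i).y =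
      decide (∑ i, w (x i) < 0) :=
    eventually_all.2 fun i => eventually_readOut N (fun i => w (x i)) rfl
      fun t => (signAlgorithm_run w N x t i).2.2
  obtain ⟨T, hT⟩ := eventually_atTop.1 h
  exact ⟨T, fun i t ht => hT t ht i⟩

end SignAlgorithm

/-! ### Running finitely many algorithms in parallel -/

section Product

variable {K : ℕ} {Y : Type*} {ι : Type} [Finite ι]

/-- The algorithm that runs the algorithms `A c` in parallel and combines their outputs by `g`. -/
def Algorithm.combine (A : ι → Algorithm K Bool) (g : (ι → Bool) → Y) : Algorithm K Y where
  -- The extra bit stores the output of component `c`, which its own transition law reads.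
  Z d := ∀ c, (A c).Z d × Bool
  M := ∀ c, (A c).M
  finite_Z d :=
    have := fun c => (A c).finite_Z d
    inferInstance
  finite_M :=
    have := fun c => (A c).finite_M
    inferInstance
  z₀ d c := ((A c).z₀ d, false)
  m₀ c := (A c).m₀
  step d k z _ m :=
    let r := fun c => (A c).step d k (z c).1 (z c).2 (fun q => m q c)
    (fun c => ((r c).1, (r c).2.1), g fun c => (r c).2.1, fun q c => (r c).2.2 q)

theorem Algorithm.combine_run (A : ι → Algorithm K Bool) (g : (ι → Bool) → Y) (y₀ : Y) {n : ℕ}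
    (N : Network n) (x : Fin n → Fin (K + 1)) (t : ℕ) :
    ∀ i, (∀ c, ((combine A g).run N y₀ x t i).z c =
        (((A c).run N false x t i).z, ((A c).run N false x t i).y)) ∧
      ∀ q c, ((combine A g).run N y₀ x t i).m q c = ((A c).run N false x t i).m q := by
  induction t with
  | zero => exact fun i => ⟨fun c => rfl, fun q c => rfl⟩
  | succ t ih =>
    intro i
    have hstep : ∀ c, (A c).step (N.deg i) (x i) (((combine A g).run N y₀ x t i).z c).1
        (((combine A g).run N y₀ x t i).z c).2
        (fun q => (combine A g).incoming N ((combine A g).run N y₀ x t) i q c) =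
        (A c).step (N.deg i) (x i) ((A c).run N false x t i).z ((A c).run N false x t i).y
          ((A c).incoming N ((A c).run N false x t) i) := by
      intro c
      rw [(ih i).1 c]
      congr 1
      funext q
      exact (ih _).2 _ c
    exact ⟨fun c => congrArg (fun r => (r.1, r.2.1)) (hstep c),
      fun q c => congrArg (fun r => r.2.2 q) (hstep c)⟩

theorem Algorithm.combine_terminates {A : ι → Algorithm K Bool} (g : (ι → Bool) → Y) (y₀ : Y)
    {n : ℕ} {N : Network n} {x : Fin n → Fin (K + 1)} {b : ι → Bool}
    (h : ∀ c, (A c).TerminatesWith N false x (b c)) :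
    (combine A g).TerminatesWith N y₀ x (g b) := by
  choose T hT using h
  obtain ⟨T', hT'⟩ := (Set.finite_range T).bddAbove
  -- At time `0` the output is `y₀`, not a value of `g`; hence the `+ 1`.
  refine ⟨T' + 1, fun i t ht => ?_⟩
  obtain ⟨t, rfl⟩ : ∃ s, t = s + 1 := ⟨t - 1, by omega⟩
  have hy : ((combine A g).run N y₀ x (t + 1) i).y =
      g fun c => (((combine A g).run N y₀ x (t + 1) i).z c).2 := rfl
  rw [hy]
  congr 1
  funext c
  rw [(combine_run A g y₀ N x (t + 1) i).1 c]
  exact hT c i _ (by have := hT' ⟨c, rfl⟩; omega)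

end Product

/-! ### Linear inequalities as signs of integer sums -/

theorem sum_mul_freq {K n : ℕ} (x : Fin n → Fin (K + 1)) (a : Fin (K + 1) → ℝ) :
    ∑ k, a k * freq x k = (∑ i, a (x i)) / n := by
  rw [← Finset.sum_fiberwise' Finset.univ x a, Finset.sum_div]
  refine Finset.sum_congr rfl fun k _ => ?_
  rw [Finset.sum_const, nsmul_eq_mul, freq]
  ring

/-- Rational numbers have a common positive denominator. -/
theorem exists_common_denominator {ι : Type*} [Fintype ι] (a : ι → ℚ) :
    ∃ D : ℚ, 0 < D ∧ ∃ w : ι → ℤ, ∀ i, (w i : ℚ) = D * a i := by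
  obtain ⟨⟨D, hD⟩, h⟩ := IsLocalization.exist_integer_multiples_of_finite (nonZeroDivisors ℤ) a
  have hD0 : D ≠ 0 := nonZeroDivisors.ne_zero hD
  choose w hw using h
  -- `D` may be negative, so its square serves as the denominator.
  refine ⟨((D * D : ℤ) : ℚ), by exact_mod_cast mul_self_pos.2 hD0, fun i => D * w i, fun i => ?_⟩
  have := hw i
  simp only [Algebra.smul_def, algebraMap_int_eq, eq_intCast] at this
  push_cast
  rw [this]
  ring

/-- The membership in the solution set of a rational linear inequality is decided, on all
networks, by the sign of a sum of integer weights. -/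
theorem LinIneq.exists_weights {K : ℕ} (c : LinIneq K) : ∃ w : Fin (K + 1) → ℤ,
    ∀ (n : ℕ) (hn : 0 < n) (x : Fin n → Fin (K + 1)),
      (⟨freq x, freq_mem hn x⟩ ∈ c.solutions ↔ (∑ i, w (x i) < 0 ↔ c.strict = true)) := by
  obtain ⟨D, hD, w, hw⟩ := exists_common_denominator fun k => c.coeff k - c.bound
  have hDR : (0 : ℝ) < D := by exact_mod_cast hD
  have hsum : ∀ (n : ℕ) (_ : 0 < n) (x : Fin n → Fin (K + 1)), ((∑ i, w (x i) : ℤ) : ℝ) =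
      D * n * (∑ k, (c.coeff k : ℝ) * freq x k - c.bound) := by
    intro n hn x
    have hn' : (n : ℝ) ≠ 0 := by positivity
    have hwR : ∀ k, (w k : ℝ) = D * (c.coeff k - c.bound) := fun k => by exact_mod_cast hw k
    rw [sum_mul_freq x (fun k => (c.coeff k : ℝ))]
    push_cast
    simp only [hwR, ← Finset.mul_sum, Finset.sum_sub_distrib, Finset.sum_const,
      Finset.card_univ, Fintype.card_fin, nsmul_eq_mul]
    field_simp
  by_cases hs : c.strict = true
  · refine ⟨w, fun n hn x => ?_⟩
    have hpos : (0 : ℝ) < D * n := by positivity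
    simp only [LinIneq.solutions, hs, if_true, Set.mem_ofPred_eq, iff_true]
    rw [← Int.cast_lt (R := ℝ), hsum n hn x, Int.cast_zero, ← not_le, ← not_le,
      mul_nonneg_iff_of_pos_left hpos, sub_nonneg]
  -- A non-strict inequality is the negation of a strict one with opposite signs.
  · refine ⟨-w, fun n hn x => ?_⟩
    have hpos : (0 : ℝ) < D * n := by positivity
    simp only [LinIneq.solutions, hs, Set.mem_ofPred_eq, iff_false, Pi.neg_apply,
      Finset.sum_neg_distrib, neg_lt_zero, not_lt, if_false, Bool.false_eq_true]
    rw [← Int.cast_le (R := ℝ), hsum n hn x, Int.cast_zero,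
      ← not_lt, ← not_lt, mul_pos_iff_of_pos_left hpos, sub_pos]

/-- A function all of whose level sets are finite unions of rational cells factors through the
truth values of finitely many rational linear inequalities. -/
theorem exists_finite_determining {K : ℕ} {Y : Type*} [Finite Y]
    {h : stdSimplex ℝ (Fin (K + 1)) → Y}
    (hlevel : ∀ y : Y, IsFiniteUnionOfCells (levelSet h y)) :
    ∃ T : Set (LinIneq K), T.Finite ∧
      ∀ p q, (∀ c ∈ T, p ∈ c.solutions ↔ q ∈ c.solutions) → h p = h q := by
  choose F hF hcell hL using hlevel
  choose T hT hC using hcell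
  refine ⟨⋃ y, ⋃ C, ⋃ hCF : C ∈ F y, T y C hCF,
    Set.finite_iUnion fun y => (hF y).biUnion' fun C hCF => hT y C hCF, fun p q hpq => ?_⟩
  have hp : p ∈ levelSet h (h p) := rfl
  rw [hL] at hp
  obtain ⟨C, hCF, hpC⟩ := hp
  have hq : q ∈ levelSet h (h p) := by
    rw [hL]
    refine ⟨C, hCF, ?_⟩
    rw [hC _ C hCF] at hpC ⊢
    simp only [Set.mem_iInter] at hpC ⊢
    exact fun c hc => (hpq c (Set.mem_iUnion.2 ⟨h p, Set.mem_iUnion₂.2 ⟨C, hCF, hc⟩⟩)).1 (hpC c hc)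
  exact hq.symm

end AnonNet

/-! ### Assembling the deciders. -/

theorem mainTheorem4 {K : ℕ} {Y : Type*} [Finite Y] (y₀ : Y)
    (h : stdSimplex ℝ (Fin (K + 1)) → Y)
    (hlevel : ∀ y : Y, AnonNet.IsFiniteUnionOfCells (AnonNet.levelSet h y)) :
    AnonNet.SimplexComputable y₀ h := by
  classical
  obtain ⟨T, hT, hdet⟩ := AnonNet.exists_finite_determining hlevel
  have := hT.to_subtype
  choose w hw using fun c : T => c.1.exists_weights
  let b (n : ℕ) (x : Fin n → Fin (K + 1)) (c : T) : Bool := decide (∑ i, w c (x i) < 0)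
  -- A sign pattern is decoded through an arbitrary point realizing it; `hdet` makes the choice
  -- harmless, and `y₀` fills in patterns that no point realizes.
  let g (β : T → Bool) : Y :=
    if hβ : ∃ p, ∀ c : T, p ∈ c.1.solutions ↔ (β c = true ↔ c.1.strict = true) then
      h hβ.choose else y₀
  refine ⟨fun n x => g (b n x), fun n hn x => ?_,
    AnonNet.Algorithm.combine (fun c => AnonNet.signAlgorithm (w c)) g, fun n N x =>
      AnonNet.Algorithm.combine_terminates g y₀ fun c =>
        AnonNet.signAlgorithm_terminates (w c) N x⟩
  have hx : ∃ p, ∀ c : T, p ∈ c.1.solutions ↔ (b n x c = true ↔ c.1.strict = true) :=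
    ⟨⟨_, AnonNet.freq_mem hn x⟩, fun c => by simpa [b] using hw c n hn x⟩
  simp only [g, dif_pos hx]
  refine hdet _ _ fun c hc => (hx.choose_spec ⟨c, hc⟩).trans ?_
  simpa [b] using (hw ⟨c, hc⟩ n hn x).symm
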